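/- A formula means a first-order formula with one free variable, without parameters, in the language of groups (multiplication, inversion and the identity element). For a formula $\varphi$ and a group $G$, let $$G_\varphi=\{g\in G \mid \varphi(g)\text{ is true in }G\}$$ be the set of $\varphi$-values in $G$, and let $\varphi(G)=\langle G_\varphi\rangle$ be the subgroup of $G$ that it generates. The formula $\varphi$ is called concise in a class $\mathcal C$ of groups if, for every $G\in\mathcal C$, finiteness of $G_\varphi$ implies finiteness of $\varphi(G)$. **Theorem.** Every formula is concise in the class of abelian groups. That is, for every formula $\varphi$ and every abelian group $G$, if $G_\varphi$ is finite, then $\varphi(G)$ is finite. -/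

import Mathlib

universe u

namespace Conciseness

/-- The function symbols of the language of groups: multiplication, inversion and the identity. -/
inductive GroupFunc : ℕ → Type
  | mul : GroupFunc 2
  | inv : GroupFunc 1
  | one : GroupFunc 0

/-- The first-order language of groups. It has no relation symbols besides equality. -/
def groupLanguage : FirstOrder.Language.{0, 0} where
  Functions := GroupFunc
  Relations := fun _ => Empty

/-- Every group is a structure for the language of groups, in the usual interpretation. -/
instance groupStructure (G : Type*) [Group G] : groupLanguage.Structure G where
  funMap := fun {n} (f : GroupFunc n) =>
    match n, f with
    | _, GroupFunc.mul => fun x => x 0 * x 1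
    | _, GroupFunc.inv => fun x => (x 0)⁻¹
    | _, GroupFunc.one => fun _ => 1
  RelMap := fun r _ => Empty.elim r

/-- First-order formulae in the language of groups (without parameters) whose only free variable
is the single element of `Unit`. -/
abbrev GroupFormula : Type := groupLanguage.Formula Unit

/-- The set of values `{g ∈ G | φ(g) is true in G}` of a formula `φ` in a group `G`. -/
def values (φ : GroupFormula) (G : Type*) [Group G] : Set G :=
  {g | φ.Realize (fun _ : Unit => g)}

/-- The subgroup `φ(G)` of `G` generated by the values of `φ`. -/
def logicalSubgroup (φ : GroupFormula) (G : Type*) [Group G] : Subgroup G :=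
  Subgroup.closure (values φ G)

/-- A formula is concise in a class `C` of groups if, for every group `G` in `C`, the subgroup
generated by the values of the formula in `G` is finite whenever the set of values is finite. -/
def IsConciseIn (φ : GroupFormula) (C : (G : Type u) → [Group G] → Prop) : Prop :=
  ∀ (G : Type u) [Group G], C G → (values φ G).Finite → Finite (logicalSubgroup φ G)

/-- The class of abelian groups. -/
def AbelianGroups (G : Type u) [Group G] : Prop :=
  ∀ a b : G, a * b = b * a

end Conciseness

open Filter FirstOrder

/-! A finitely generated torsion abelian group is finite, so it suffices that every value `g` has
finite order. Otherwise pass to an ultrapower over `ℕ`: by Łoś it still has finitely many values,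
among them the constant germ `c` of `g`. It contains a copy of `ℚ`, and some homomorphism to `ℚ`
sends `c` to 1, so transvections along that copy move `c` to infinitely many elements. Automorphisms
preserve values, a contradiction. -/

/-- `ℚ` is divisible, hence injective: the inclusion `ℤ → ℚ` extends along `n ↦ n • a`. -/
theorem exists_addMonoidHom_rat_eq_one {A : Type*} [AddCommGroup A] {a : A}
    (ha : ¬ IsOfFinAddOrder a) : ∃ s : A →+ ℚ, s a = 1 := by
  have hinj : Function.Injective (zmultiplesHom A a) := by
    intro m n h
    exact injective_zsmul_iff_not_isOfFinAddOrder.2 ha (by simpa using h)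
  obtain ⟨s, hs⟩ := (Module.Baer.of_divisible ℚ).extension_property_addMonoidHom
    (zmultiplesHom A a) hinj (Int.castAddHom ℚ)
  exact ⟨s, by simpa using DFunLike.congr_fun hs 1⟩

/-- The transvection `x ↦ x + j (q * s x)` is invertible as soon as `1 + q * s (j 1) ≠ 0`. -/
def ratTransvection {A : Type*} [AddCommGroup A] (j : ℚ →+ A) (s : A →+ ℚ) (q : ℚ)
    (hq : 1 + q * s (j 1) ≠ 0) : A ≃+ A :=
  have hsj : ∀ r : ℚ, s (j r) = r * s (j 1) := fun r => by
    simpa using map_rat_smul (s.comp j) r 1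
  { toFun := fun x => x + j (q * s x)
    invFun := fun x => x - j (q / (1 + q * s (j 1)) * s x)
    left_inv := fun x => by
      have h : q * s x = q / (1 + q * s (j 1)) * (s x + q * s x * s (j 1)) := by
        field_simp
      simp only [map_add, hsj (q * s x)]
      rw [← h, add_sub_cancel_right]
    right_inv := fun x => by
      have h : q / (1 + q * s (j 1)) * s x =
          q * (s x - q / (1 + q * s (j 1)) * s x * s (j 1)) := by
        field_simp
        ring
      simp only [map_sub, hsj (q / (1 + q * s (j 1)) * s x)]
      rw [← h, sub_add_cancel]
    map_add' := fun x y => by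
      simp only [map_add, mul_add]
      abel }

theorem infinite_range_addEquiv_apply {A : Type*} [AddCommGroup A] {j : ℚ →+ A}
    (hj : Function.Injective j) {a : A} (ha : ¬ IsOfFinAddOrder a) :
    (Set.range fun e : A ≃+ A => e a).Infinite := by
  obtain ⟨s, hs⟩ := exists_addMonoidHom_rat_eq_one ha
  have hinf : {q : ℚ | 1 + q * s (j 1) ≠ 0}.Infinite := by
    -- At most one `q` makes the transvection singular.
    have hsub : {q : ℚ | 1 + q * s (j 1) = 0}.Subsingleton := by
      intro p hp q hq
      simp only [Set.mem_ofPred_eq] at hp hq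
      have hc : s (j 1) ≠ 0 := fun h => by simp [h] at hp
      exact mul_right_cancel₀ hc (by linarith)
    exact hsub.finite.infinite_compl
  refine (hinf.image (f := fun q => a + j q) ?_).mono ?_
  · intro p _ q _ h
    exact hj (add_left_cancel h)
  · rintro _ ⟨q, hq, rfl⟩
    exact ⟨ratTransvection j s q hq, by simp [ratTransvection, hs]⟩

/-- `n!` clears the denominator of `q` once `n ≥ q.den`. Hence taking floors is eventually additive.
-/
theorem eventually_floor_mul_factorial (q : ℚ) :
    ∀ᶠ n : ℕ in atTop, ((⌊q * (n.factorial : ℚ)⌋ : ℤ) : ℚ) = q * (n.factorial : ℚ) := by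
  filter_upwards [eventually_ge_atTop q.den] with n hn
  obtain ⟨k, hk⟩ := Nat.dvd_factorial q.den_pos hn
  have h : q * (n.factorial : ℚ) = ((q.num * k : ℤ) : ℚ) := by
    rw [hk]
    push_cast
    rw [← mul_assoc, Rat.mul_den_eq_num]
  rw [h, Int.floor_intCast]

/-- The additive map from `ℚ` to an ultrapower sending `q` to the germ of `n ↦ g ^ (q * n!)`. -/
noncomputable def ratToGerm {G : Type*} [CommGroup G] (g : G) :
    ℚ →+ Additive (Germ (hyperfilter ℕ : Filter ℕ) G) :=
  AddMonoidHom.mk'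
    (fun q => Additive.ofMul ((fun n : ℕ => g ^ ⌊q * (n.factorial : ℚ)⌋ : ℕ → G) :
      Germ (hyperfilter ℕ : Filter ℕ) G))
    (fun p q => by
      rw [← ofMul_mul, ← Germ.coe_mul]
      refine congrArg Additive.ofMul (Germ.coe_eq.2 (Nat.hyperfilter_le_atTop ?_))
      filter_upwards [eventually_floor_mul_factorial p, eventually_floor_mul_factorial q,
        eventually_floor_mul_factorial (p + q)] with n hp hq hpq
      rw [Pi.mul_apply, ← zpow_add]
      congr 1
      have : ((⌊(p + q) * (n.factorial : ℚ)⌋ : ℤ) : ℚ) =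
          ((⌊p * (n.factorial : ℚ)⌋ + ⌊q * (n.factorial : ℚ)⌋ : ℤ) : ℚ) := by
        rw [Int.cast_add, hp, hq, hpq, add_mul]
      exact_mod_cast this)

theorem ratToGerm_injective {G : Type*} [CommGroup G] {g : G} (hg : ¬ IsOfFinOrder g) :
    Function.Injective (ratToGerm g) := by
  intro p q h
  have h' := Germ.coe_eq.1 (Additive.ofMul.injective h)
  obtain ⟨n, ⟨hn, hp⟩, hq⟩ := ((h'.and (Nat.hyperfilter_le_atTop
    (eventually_floor_mul_factorial p))).and (Nat.hyperfilter_le_atTop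
    (eventually_floor_mul_factorial q))).exists
  -- At this `n` the powers of `g` agree and both floors are exact.
  have hfl := injective_zpow_iff_not_isOfFinOrder.2 hg hn
  rw [hfl, hq] at hp
  exact (mul_right_cancel₀ (by exact_mod_cast n.factorial_ne_zero) hp).symm

namespace Conciseness

/-- An isomorphism of groups is an isomorphism of structures for the language of groups. -/
def languageEquiv {G H : Type*} [Group G] [Group H] (e : G ≃* H) : G ≃[groupLanguage] H where
  toEquiv := e.toEquiv
  map_fun' {n} f x := by
    cases f
    · exact map_mul e _ _
    · exact map_inv e _
    · exact map_one e
  map_rel' r _ := Empty.elim r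

theorem map_mem_values_iff {G H : Type*} [Group G] [Group H] (φ : GroupFormula) (e : G ≃* H)
    (g : G) : e g ∈ values φ H ↔ g ∈ values φ G :=
  Language.StrongHomClass.realize_formula (languageEquiv e) φ (v := fun _ => g)

/-- The model-theoretic ultrapower of a group is its group of germs. -/
def productEquivGerm (G : Type*) [Group G] {ι : Type*} (u : Ultrafilter ι) :
    (u : Filter ι).Product (fun _ => G) ≃[groupLanguage] Germ (u : Filter ι) G where
  toEquiv := Equiv.refl _
  map_fun' {n} f x := by
    choose y hy using fun i => Quotient.exists_rep (x i)
    obtain rfl : x = fun i => ((y i : ι → G) : (u : Filter ι).Product fun _ => G) :=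
      funext fun i => (hy i).symm
    refine (Language.Ultraproduct.funMap_cast f y).trans ?_
    cases f <;> rfl
  map_rel' r _ := Empty.elim r

theorem coe_mem_values_germ_iff {G : Type*} [Group G] {ι : Type*} (u : Ultrafilter ι)
    (φ : GroupFormula) (f : ι → G) :
    (f : Germ (u : Filter ι) G) ∈ values φ (Germ (u : Filter ι) G) ↔
      ∀ᶠ i in (u : Filter ι), f i ∈ values φ G :=
  (Language.StrongHomClass.realize_formula (productEquivGerm G u) φ
    (v := fun _ => ((f : ι → G) : (u : Filter ι).Product fun _ => G))).trans
    (Language.Ultraproduct.realize_formula_cast φ fun _ => f)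

/-- A function with values in a finite set `u`-almost everywhere is constant on a set in `u`, so
every value is a constant germ. -/
theorem finite_values_germ {G : Type*} [Group G] {ι : Type*} (u : Ultrafilter ι)
    (φ : GroupFormula) (hφ : (values φ G).Finite) :
    (values φ (Germ (u : Filter ι) G)).Finite := by
  refine (hφ.image fun a : G => ((fun _ => a : ι → G) : Germ (u : Filter ι) G)).subset ?_
  intro x hx
  induction x using Germ.inductionOn with
  | _ f =>
    rw [coe_mem_values_germ_iff] at hx
    obtain ⟨a, ha, h⟩ := (Ultrafilter.eventually_exists_mem_iff hφ
      (P := fun a i => f i = a)).1 (hx.mono fun i hi => ⟨f i, hi, rfl⟩)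
    exact ⟨a, ha, (Germ.coe_eq.2 h).symm⟩

theorem isOfFinOrder_of_mem_values {G : Type*} [CommGroup G] {φ : GroupFormula}
    (hφ : (values φ G).Finite) {g : G} (hg : g ∈ values φ G) : IsOfFinOrder g := by
  by_contra hord
  let u : Ultrafilter ℕ := hyperfilter ℕ
  let c : Germ (u : Filter ℕ) G := ((fun _ => g : ℕ → G) : Germ (u : Filter ℕ) G)
  have hc : ¬ IsOfFinAddOrder (Additive.ofMul c) := by
    rw [isOfFinAddOrder_ofMul_iff, isOfFinOrder_iff_pow_eq_one]
    rintro ⟨n, hn, h⟩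
    rw [← Germ.coe_pow, ← Germ.coe_one, Germ.coe_eq] at h
    obtain ⟨_, hk⟩ := h.exists
    exact hord (isOfFinOrder_iff_pow_eq_one.2 ⟨n, hn, hk⟩)
  have hcv : c ∈ values φ (Germ (u : Filter ℕ) G) :=
    (coe_mem_values_germ_iff u φ _).2 (Eventually.of_forall fun _ => hg)
  refine infinite_range_addEquiv_apply (ratToGerm_injective hord) hc
    (((finite_values_germ u φ hφ).image Additive.ofMul).subset ?_)
  rintro _ ⟨e, rfl⟩
  exact ⟨_, (map_mem_values_iff φ (MulEquiv.toAdditive.symm e) c).2 hcv, rfl⟩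

end Conciseness

theorem Subgroup.finite_closure_of_isOfFinOrder {G : Type*} [CommGroup G] {s : Set G}
    (hs : s.Finite) (h : ∀ g ∈ s, IsOfFinOrder g) : Finite (Subgroup.closure s) := by
  have hle : Subgroup.closure s ≤ CommGroup.torsion G := (Subgroup.closure_le _).2 h
  have : Group.FG (Subgroup.closure s) :=
    (Group.fg_iff_subgroup_fg _).2 ⟨hs.toFinset, by simp⟩
  refine CommGroup.finite_of_fg_isMulTorsion _ fun x => ?_
  exact (Subgroup.subtype_injective _).isOfFinOrder_iff.1 (hle x.2)

theorem theorem1p1 (φ : Conciseness.GroupFormula) :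
    Conciseness.IsConciseIn φ Conciseness.AbelianGroups.{u} := by
  intro G _ hG hφ
  let _ : CommGroup G := { ‹Group G› with mul_comm := fun a b => hG a b }
  exact Subgroup.finite_closure_of_isOfFinOrder hφ fun g hg =>
    Conciseness.isOfFinOrder_of_mem_values hφ hg
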